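/- Let $k,\ell\ge 1$ be integers, let $a<b$ be real numbers, and let $s_1<\dots<s_k$ be the positions of $k$ servers on the real line, all in $[a,b]$, each of capacity $\ell$. Requests $r_1,\dots,r_n\in\mathbb{R}$ with $n\le k\ell$ arrive one by one. An online algorithm must match each request $r_i$ on its arrival irrevocably with a free server, i.e. one that is so far matched with fewer than $\ell$ requests, at cost $|r_i-s_j|$ if the server is $s_j$ (problem $\mathrm{OFAL}(k,\ell)$). For $a\le x<y\le b$ let $$B(x,y)=\frac{(b-x)y+(y-a)x}{(b-x)+(y-a)},$$ the point dividing $[x,y]$ internally in the ratio $b-x$ to $y-a$. For $\rho\in\mathbb{R}$ and $x,y\in[a,b]$ write $x\preceq_\rho y$ if $x=y$, or $x<y$ and $B(x,y)<\rho$, or $y<x$ and $\rho\le B(y,x)$. The algorithm $\mathrm{IDAS}_{[a,b]}$ matches each request $r$ with the highest free server with respect to $\preceq_r$, i.e. the free server $s$ such that $s'\preceq_r s$ for all free servers $s'$. Then: 1. $\mathrm{IDAS}_{[a,b]}$ is an MPFS (most preferred free servers) algorithm: there is a priority order on the servers for each request, determined by the position of the request only, such that each request is matched with the free server of highest priority.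 2. $\mathrm{IDAS}_{[a,b]}$ chooses between the surrounding free servers by interior division: a request $r$ that arrives at the position of a free server is matched with that server. Otherwise let $s^L$ and $s^R$ be the closest free servers to the left and to the right of $r$. If only one of them exists, $r$ is matched with it; if both exist, $r$ is matched with $s^L$ if $r\le B(s^L,s^R)$ and with $s^R$ if $B(s^L,s^R)<r$. 3. The competitive ratio of $\mathrm{IDAS}_{[a,b]}$ for $\mathrm{OFAL}(k,\ell)$ satisfies $$\mathcal{R}(\mathrm{IDAS}_{[a,b]})\le 2\cdot\frac{b-a}{d_{\min}}+1,\qquad d_{\min}=\min_{1\le j\le k-1}(s_{j+1}-s_j),$$ where for $k=1$ the quotient $\frac{b-a}{d_{\min}}$ is read as $0$. Here $\mathcal{R}(\mathrm{ALG})$ is the infimum of all $c\ge 1$ such that the cost of $\mathrm{ALG}$ is at most $c$ times the cost of an optimal offline matching (one that matches at most $\ell$ requests with each server) for every request sequence of length at most $k\ell$. -/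

import Mathlib

namespace OFAL

/-- The number of requests that the assignment `x` (request `i` goes to server `x i`) gives to
server `j`. -/
def load {n k : ℕ} (x : Fin n → Fin k) (j : Fin k) : ℕ :=
  (Finset.univ.filter fun i => x i = j).card

/-- A server is free (for capacity `ℓ`) if it is matched with fewer than `ℓ` requests so far. -/
def IsFree {n k : ℕ} (ℓ : ℕ) (x : Fin n → Fin k) (j : Fin k) : Prop :=
  load x j < ℓ

/-- An assignment of all requests to servers that respects the uniform capacity `ℓ`. -/
def IsFeasible {n k : ℕ} (ℓ : ℕ) (x : Fin n → Fin k) : Prop :=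
  ∀ j, load x j ≤ ℓ

/-- The cost of an assignment: the sum of the distances on the line between the requests (at the
positions `σ i`) and their servers (at the positions `p j`). -/
noncomputable def matchingCost {n k : ℕ} (p : Fin k → ℝ) (σ : Fin n → ℝ) (x : Fin n → Fin k) : ℝ :=
  ∑ i, |σ i - p (x i)|

/-- The optimal offline cost. For `n ≤ k * ℓ` the infimum runs over a finite nonempty set, so that
it is a minimum. -/
noncomputable def opt {n k : ℕ} (ℓ : ℕ) (p : Fin k → ℝ) (σ : Fin n → ℝ) : ℝ :=
  ⨅ x : {x : Fin n → Fin k // IsFeasible ℓ x}, matchingCost p σ x.1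

/-- A deterministic online algorithm for `k` servers of capacity `ℓ` on a line: it is given the past
requests, the servers they were matched with and the position of the current request, and it
answers with a server, which has to be free (as long as there is a free server). -/
structure OnlineAlgorithm (k ℓ : ℕ) where
  choose : ∀ {n : ℕ}, (Fin n → ℝ) → (Fin n → Fin k) → ℝ → Fin k
  choose_free : ∀ {n : ℕ} (σ : Fin n → ℝ) (x : Fin n → Fin k) (r : ℝ),
    (∃ j, IsFree ℓ x j) → IsFree ℓ x (choose σ x r)

namespace OnlineAlgorithm

variable {k ℓ : ℕ}

/-- The assignment that the algorithm produces on the request sequence `σ 0, σ 1, …`: the last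
request is matched after the earlier ones have been processed. -/
def run (A : OnlineAlgorithm k ℓ) : ∀ {n : ℕ}, (Fin n → ℝ) → Fin n → Fin k
  | 0, _ => Fin.elim0
  | n + 1, σ =>
    Fin.snoc (α := fun _ => Fin k) (A.run (Fin.init σ))
      (A.choose (Fin.init σ) (A.run (Fin.init σ)) (σ (Fin.last n)))

/-- The server with which the algorithm matches a request at `r` that arrives right after the
algorithm has processed `σ`. -/
def next (A : OnlineAlgorithm k ℓ) {n : ℕ} (σ : Fin n → ℝ) (r : ℝ) : Fin k :=
  A.choose σ (A.run σ) r

/-- The total cost of the algorithm on `σ`, for servers at the positions `p`. -/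
noncomputable def cost (A : OnlineAlgorithm k ℓ) (p : Fin k → ℝ) {n : ℕ} (σ : Fin n → ℝ) : ℝ :=
  matchingCost p σ (A.run σ)

/-- `c`-competitiveness (strict, without additive constant), over all request sequences that the
servers can accommodate. -/
def IsCompetitive (A : OnlineAlgorithm k ℓ) (p : Fin k → ℝ) (c : ℝ) : Prop :=
  ∀ (n : ℕ) (σ : Fin n → ℝ), n ≤ k * ℓ → A.cost p σ ≤ c * opt ℓ p σ

/-- The competitive ratio: the infimum of the `c ≥ 1` such that the algorithm is `c`-competitive,
and `⊤` if there is no such `c`. -/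
noncomputable def competitiveRatio (A : OnlineAlgorithm k ℓ) (p : Fin k → ℝ) : EReal :=
  ⨅ (c : ℝ) (_ : 1 ≤ c) (_ : A.IsCompetitive p c), (c : EReal)

/-- MPFS (most preferred free servers) algorithms: there is, for each position of a request, a
priority order on the servers that depends on this position only, and each request is matched with
the free server of highest priority. -/
def IsMPFS (A : OnlineAlgorithm k ℓ) : Prop :=
  ∃ prio : ℝ → LinearOrder (Fin k), ∀ (n : ℕ) (σ : Fin n → ℝ) (r : ℝ), n < k * ℓ →
    IsFree ℓ (A.run σ) (A.next σ r) ∧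
      ∀ j, IsFree ℓ (A.run σ) j → (prio r).le j (A.next σ r)

end OnlineAlgorithm

/-- The smallest distance between neighbouring servers. For a single server there is no distance and
the value is `0`, so that a quotient `t / dMin p` is then `0`. -/
noncomputable def dMin {k : ℕ} (p : Fin k → ℝ) : ℝ :=
  ⨅ i : Fin (k - 1), (p ⟨i + 1, by omega⟩ - p ⟨i, by omega⟩)

/-- The point `B(x, y)` dividing `[x, y] ⊆ [a, b]` internally in the ratio `b - x` to `y - a`. -/
noncomputable def B (a b x y : ℝ) : ℝ :=
  ((b - x) * y + (y - a) * x) / ((b - x) + (y - a))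

/-- The order `x ⪯_ρ y` on `[a, b]`. -/
def Prec (a b ρ x y : ℝ) : Prop :=
  x = y ∨ (x < y ∧ B a b x y < ρ) ∨ (y < x ∧ ρ ≤ B a b y x)

/-- `j` is the highest free server with respect to `⪯_r`. -/
def IsHighestFree {n k : ℕ} (ℓ : ℕ) (a b : ℝ) (p : Fin k → ℝ) (x : Fin n → Fin k) (r : ℝ)
    (j : Fin k) : Prop :=
  IsFree ℓ x j ∧ ∀ j', IsFree ℓ x j' → Prec a b r (p j') (p j)

/-- `L` is the closest free server strictly to the left of `r`. -/
def IsLeftSurrounding {n k : ℕ} (ℓ : ℕ) (p : Fin k → ℝ) (x : Fin n → Fin k) (r : ℝ)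
    (L : Fin k) : Prop :=
  IsFree ℓ x L ∧ p L < r ∧ ∀ j, IsFree ℓ x j → p j < r → p j ≤ p L

/-- `R` is the closest free server strictly to the right of `r`. -/
def IsRightSurrounding {n k : ℕ} (ℓ : ℕ) (p : Fin k → ℝ) (x : Fin n → Fin k) (r : ℝ)
    (R : Fin k) : Prop :=
  IsFree ℓ x R ∧ r < p R ∧ ∀ j, IsFree ℓ x j → r < p j → p R ≤ p j

/-- The description by surrounding servers: a request that arrives at a free server is matched with
it; otherwise, a request with a unique surrounding server is matched with that one, and a request
with the two surrounding servers `L` and `R` is matched with `L` if `r ≤ B(L, R)` and with `R` if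
`B(L, R) < r`. -/
def OnlineAlgorithm.FollowsInteriorDivision {k ℓ : ℕ} (A : OnlineAlgorithm k ℓ) (a b : ℝ)
    (p : Fin k → ℝ) : Prop :=
  ∀ (n : ℕ) (σ : Fin n → ℝ) (r : ℝ), n < k * ℓ →
    (∀ j, IsFree ℓ (A.run σ) j → p j = r → A.next σ r = j) ∧
    ((∀ j, IsFree ℓ (A.run σ) j → p j ≠ r) →
      (∀ L, IsLeftSurrounding ℓ p (A.run σ) r L →
        (¬ ∃ R, IsRightSurrounding ℓ p (A.run σ) r R) → A.next σ r = L) ∧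
      (∀ R, IsRightSurrounding ℓ p (A.run σ) r R →
        (¬ ∃ L, IsLeftSurrounding ℓ p (A.run σ) r L) → A.next σ r = R) ∧
      (∀ L R, IsLeftSurrounding ℓ p (A.run σ) r L → IsRightSurrounding ℓ p (A.run σ) r R →
        (r ≤ B a b (p L) (p R) → A.next σ r = L) ∧
        (B a b (p L) (p R) < r → A.next σ r = R)))

theorem B_lt_B_right {a b x y z : ℝ} (hx : a ≤ x) (hxy : x < y) (hyz : y < z) (hz : z ≤ b) :
    B a b x y < B a b x z := by
  unfold B
  rw [div_lt_div_iff₀ (by linarith) (by linarith)]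
  nlinarith [mul_pos (mul_pos (show 0 < b - a by linarith) (show 0 < z - y by linarith))
    (show 0 < b - x by linarith)]

theorem B_lt_B_left {a b x y z : ℝ} (hx : a ≤ x) (hxy : x < y) (hyz : y < z) (hz : z ≤ b) :
    B a b x z < B a b y z := by
  unfold B
  rw [div_lt_div_iff₀ (by linarith) (by linarith)]
  nlinarith [mul_pos (mul_pos (show 0 < b - a by linarith) (show 0 < y - x by linarith))
    (show 0 < z - a by linarith)]

theorem Prec.total (a b ρ x y : ℝ) : Prec a b ρ x y ∨ Prec a b ρ y x := by
  unfold Prec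
  rcases lt_trichotomy x y with h | h | h
  · rcases lt_or_ge (B a b x y) ρ with h' | h'
    · exact Or.inl (Or.inr (Or.inl ⟨h, h'⟩))
    · exact Or.inr (Or.inr (Or.inr ⟨h, h'⟩))
  · exact Or.inl (Or.inl h)
  · rcases lt_or_ge (B a b y x) ρ with h' | h'
    · exact Or.inr (Or.inr (Or.inl ⟨h, h'⟩))
    · exact Or.inl (Or.inr (Or.inr ⟨h, h'⟩))

theorem Prec.trans {a b ρ x y z : ℝ} (hx : x ∈ Set.Icc a b) (hy : y ∈ Set.Icc a b)
    (hz : z ∈ Set.Icc a b) (h₁ : Prec a b ρ x y) (h₂ : Prec a b ρ y z) : Prec a b ρ x z := by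
  obtain ⟨ax, xb⟩ := hx
  obtain ⟨ay, yb⟩ := hy
  obtain ⟨az, zb⟩ := hz
  rcases h₁ with rfl | ⟨h₁, h₁'⟩ | ⟨h₁, h₁'⟩
  · exact h₂
  · rcases h₂ with rfl | ⟨h₂, h₂'⟩ | ⟨h₂, h₂'⟩
    · exact Or.inr (Or.inl ⟨h₁, h₁'⟩)
    · exact Or.inr (Or.inl ⟨h₁.trans h₂, (B_lt_B_left ax h₁ h₂ zb).trans h₂'⟩)
    · rcases lt_trichotomy x z with h | h | h
      · exact Or.inr (Or.inl ⟨h, (B_lt_B_right ax h h₂ yb).trans h₁'⟩)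
      · exact Or.inl h
      · linarith [B_lt_B_left az h h₁ yb]
  · rcases h₂ with rfl | ⟨h₂, h₂'⟩ | ⟨h₂, h₂'⟩
    · exact Or.inr (Or.inr ⟨h₁, h₁'⟩)
    · rcases lt_trichotomy x z with h | h | h
      · linarith [B_lt_B_right ay h₁ h zb]
      · exact Or.inl h
      · exact Or.inr (Or.inr ⟨h, h₁'.trans (B_lt_B_left ay h₂ h xb).le⟩)
    · exact Or.inr (Or.inr ⟨h₂.trans h₁, h₂'.trans (B_lt_B_right az h₂ h₁ xb).le⟩)

theorem exists_isHighestFree {n k : ℕ} (ℓ : ℕ) {a b : ℝ} {p : Fin k → ℝ}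
    (hp : ∀ j, p j ∈ Set.Icc a b) (x : Fin n → Fin k) (r : ℝ) (h : ∃ j, IsFree ℓ x j) :
    ∃ j, IsHighestFree ℓ a b p x r j := by
  classical
  have key : ∀ s : Finset (Fin k), s.Nonempty →
      ∃ j ∈ s, ∀ j' ∈ s, Prec a b r (p j') (p j) := by
    intro s hs
    induction hs using Finset.Nonempty.cons_induction with
    | singleton i =>
      exact ⟨i, by simp, fun j' hj' => Or.inl (by rw [Finset.mem_singleton.1 hj'])⟩
    | cons i s hi hs ih =>
      obtain ⟨j, hj, hmax⟩ := ih
      rcases Prec.total a b r (p i) (p j) with h | h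
      · refine ⟨j, by simp [hj], fun j' hj' => ?_⟩
        rcases Finset.mem_cons.1 hj' with rfl | hj'
        · exact h
        · exact hmax j' hj'
      · refine ⟨i, by simp, fun j' hj' => ?_⟩
        rcases Finset.mem_cons.1 hj' with rfl | hj'
        · exact Or.inl rfl
        · exact (hmax j' hj').trans (hp _) (hp _) (hp _) h
  obtain ⟨j₀, hj₀⟩ := h
  obtain ⟨j, hj, hmax⟩ := key (Finset.univ.filter fun j => IsFree ℓ x j) ⟨j₀, by simpa using hj₀⟩
  exact ⟨j, by simpa using hj, fun j' hj' => hmax j' (by simpa using hj')⟩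

/-- The algorithm IDAS on `[a, b]` (Interior Division for Adjacent Servers), for servers of capacity
`ℓ` at the positions `p j ∈ [a, b]`: a request at `r` is matched with the highest free server with
respect to `⪯_r`. (If no server is free, the answer is arbitrary.) -/
noncomputable def idas {k : ℕ} [NeZero k] (ℓ : ℕ) (a b : ℝ) (p : Fin k → ℝ)
    (hp : ∀ j, p j ∈ Set.Icc a b) : OnlineAlgorithm k ℓ where
  choose _ x r := Classical.epsilon fun j => IsHighestFree ℓ a b p x r j
  choose_free _ x r h := (Classical.epsilon_spec (exists_isHighestFree ℓ hp x r h)).1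

end OFAL

/-! Write `D = (b - a) / dMin p`. The ratio comes from a potential built backwards in time, starting
from `0` on the servers that stay free. Undoing the request that filled a server `t` reinserts `t`,
with potential the maximum of `0` and `φ v + |p t - p v|` over the neighbouring free servers `v`.
Since `B` increases strictly in both endpoints, a highest server displaced by `t` is a neighbour of
`t`; so for every request position, distance to the highest server plus its potential never
decreases (`IsHighest.add_le_of_insert`). Hence each request costs at most what its highest server
among all servers would charge (`exists_isPotential_of_run`).

The bounds in `IsPotential` survive reinsertion: moving an endpoint changes both sides by the same
distance. Between consecutive servers they meet the choice of `B`: a request sent past `B` has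
travelled far enough to pay for the jump of the potential. So this charge is at most `2 * D + 1`
times the distance to any server, plus that server's potential (`IsPotential.add_le_of_isHighest`).
Summed over all requests the potentials drop out, as only servers filled by IDAS carry any. -/

namespace OFAL

open Function

/-! ### The division point and the order -/

section Division

variable {a b x y ρ : ℝ}

theorem B_sub_left (h : (b - x) + (y - a) ≠ 0) :
    B a b x y - x = (y - x) * (b - x) / ((b - x) + (y - a)) := by
  unfold B
  field_simp
  ring

theorem right_sub_B (h : (b - x) + (y - a) ≠ 0) :
    y - B a b x y = (y - x) * (y - a) / ((b - x) + (y - a)) := by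
  unfold B
  field_simp
  ring

theorem left_lt_B (hx : a ≤ x) (hxy : x < y) (hy : y ≤ b) : x < B a b x y := by
  have h := B_sub_left (a := a) (b := b) (x := x) (y := y) (by linarith)
  have : 0 < (y - x) * (b - x) / ((b - x) + (y - a)) :=
    div_pos (mul_pos (by linarith) (by linarith)) (by linarith)
  linarith

theorem B_lt_right (hx : a ≤ x) (hxy : x < y) (hy : y ≤ b) : B a b x y < y := by
  have h := right_sub_B (a := a) (b := b) (x := x) (y := y) (by linarith)
  have : 0 < (y - x) * (y - a) / ((b - x) + (y - a)) :=
    div_pos (mul_pos (by linarith) (by linarith)) (by linarith)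
  linarith

theorem Prec.refl (a b ρ x : ℝ) : Prec a b ρ x x := Or.inl rfl

theorem Prec.antisymm (h₁ : Prec a b ρ x y) (h₂ : Prec a b ρ y x) : x = y := by
  rcases h₁ with h₁ | ⟨h₁, h₁'⟩ | ⟨h₁, h₁'⟩
  · exact h₁
  · rcases h₂ with h₂ | ⟨h₂, h₂'⟩ | ⟨h₂, h₂'⟩ <;> linarith
  · rcases h₂ with h₂ | ⟨h₂, h₂'⟩ | ⟨h₂, h₂'⟩ <;> linarith

theorem Prec.B_lt (h : Prec a b ρ x y) (hxy : x < y) : B a b x y < ρ := by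
  rcases h with h | ⟨_, h⟩ | ⟨h, _⟩
  · exact absurd h hxy.ne
  · exact h
  · exact absurd h hxy.not_gt

theorem Prec.le_B (h : Prec a b ρ y x) (hxy : x < y) : ρ ≤ B a b x y := by
  rcases h with h | ⟨h, _⟩ | ⟨_, h⟩
  · exact absurd h hxy.ne'
  · exact absurd h hxy.not_gt
  · exact h

end Division

/-! ### Potentials under insertion of a server -/

section Potential

variable {k : ℕ} {a b : ℝ} {p : Fin k → ℝ} {S T : Set (Fin k)} {φ : Fin k → ℝ} {r : ℝ}
  {i j t w w' : Fin k}

/-- `j` is the highest server of `S` with respect to `⪯_r`. -/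
def IsHighest (a b : ℝ) (p : Fin k → ℝ) (S : Set (Fin k)) (r : ℝ) (j : Fin k) : Prop :=
  j ∈ S ∧ ∀ j' ∈ S, Prec a b r (p j') (p j)

theorem IsHighest.unique (hinj : Injective p) (hi : IsHighest a b p S r i)
    (hj : IsHighest a b p S r j) : i = j :=
  hinj ((hj.2 i hi.1).antisymm (hi.2 j hj.1))

/-- No server of `S` lies strictly between the servers `i` and `j`. -/
def IsAdjacent (S : Set (Fin k)) (i j : Fin k) : Prop :=
  ∀ m ∈ S, ¬ (i < m ∧ m < j) ∧ ¬ (j < m ∧ m < i)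

theorem IsAdjacent.symm (h : IsAdjacent S i j) : IsAdjacent S j i :=
  fun m hm => (h m hm).symm

theorem IsAdjacent.mono (hST : S ⊆ T) (h : IsAdjacent T i j) : IsAdjacent S i j :=
  fun m hm => h m (hST hm)

/-- Potentials on the servers of `S` that vary in a controlled way between neighbours. -/
structure IsPotential (a b : ℝ) (p : Fin k → ℝ) (S : Set (Fin k)) (φ : Fin k → ℝ) : Prop where
  nonneg : ∀ j ∈ S, 0 ≤ φ j
  left_le : ∀ i ∈ S, ∀ j ∈ S, i < j → IsAdjacent S i j → φ i ≤ φ j + (p i + p j - 2 * a)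
  right_le : ∀ i ∈ S, ∀ j ∈ S, i < j → IsAdjacent S i j → φ j ≤ φ i + (2 * b - p i - p j)

/-- A potential extends to one further server, with a value that is at least the value at each
neighbour plus the distance to it. -/
theorem IsPotential.exists_update (hmono : StrictMono p) (hp : ∀ j, p j ∈ Set.Icc a b)
    (hφ : IsPotential a b p S φ) (ht : t ∉ S) :
    ∃ c, IsPotential a b p (insert t S) (update φ t c) ∧
      ∀ v ∈ S, IsAdjacent S v t → φ v + |p t - p v| ≤ c := by
  obtain ⟨c, hc, hmax⟩ := Set.exists_max_image
    (insert 0 ((fun v => φ v + |p t - p v|) '' {v | v ∈ S ∧ IsAdjacent S v t})) id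
    (((Set.toFinite _).image _).insert _) (Set.insert_nonempty _ _)
  have hlow : ∀ v ∈ S, IsAdjacent S v t → φ v + |p t - p v| ≤ c := fun v hv hvt =>
    hmax _ (Or.inr ⟨v, ⟨hv, hvt⟩, rfl⟩)
  have hc0 : 0 ≤ c := hmax _ (Or.inl rfl)
  have hne : ∀ v ∈ S, v ≠ t := fun v hv h => ht (h ▸ hv)
  have hright : ∀ v ∈ S, IsAdjacent S v t → t < v → c ≤ φ v + (p t + p v - 2 * a) := by
    intro v hv hvt htv
    have h0 := hφ.nonneg v hv
    have := (hp t).1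
    have := (hp v).1
    rcases hc with rfl | ⟨w, ⟨hw, hwt⟩, rfl⟩
    · linarith
    · dsimp only
      rcases (hne w hw).lt_or_gt with h | h
      -- Once `t` is removed, its two neighbours `w < t < v` are adjacent in `S`, and adding `p t -
      -- p w` to their bound gives exactly the bound for `t` and `v`.
      · have := hφ.left_le w hw v hv (h.trans htv) fun m hm => ⟨fun hm' => by
          rcases (hne m hm).lt_or_gt with h' | h'
          · exact (hwt m hm).1 ⟨hm'.1, h'⟩
          · exact (hvt m hm).2 ⟨h', hm'.2⟩, fun hm' => by omega⟩
        rw [abs_of_pos (sub_pos.2 (hmono h))]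
        linarith
      · have : w = v := by
          rcases lt_trichotomy w v with h' | h' | h'
          · exact absurd ⟨h, h'⟩ (hvt w hw).2
          · exact h'
          · exact absurd ⟨htv, h'⟩ (hwt v hv).2
        subst this
        rw [abs_of_neg (sub_neg.2 (hmono h))]
        linarith
  have hleft : ∀ v ∈ S, IsAdjacent S v t → v < t → c ≤ φ v + (2 * b - p v - p t) := by
    intro v hv hvt htv
    have h0 := hφ.nonneg v hv
    have := (hp t).2
    have := (hp v).2
    rcases hc with rfl | ⟨w, ⟨hw, hwt⟩, rfl⟩
    · linarith
    · dsimp only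
      rcases (hne w hw).lt_or_gt with h | h
      · have : w = v := by
          rcases lt_trichotomy w v with h' | h' | h'
          · exact absurd ⟨h', htv⟩ (hwt v hv).1
          · exact h'
          · exact absurd ⟨h', h⟩ (hvt w hw).1
        subst this
        rw [abs_of_pos (sub_pos.2 (hmono h))]
        linarith
      · have := hφ.right_le v hv w hw (htv.trans h) fun m hm => ⟨fun hm' => by
          rcases (hne m hm).lt_or_gt with h' | h'
          · exact (hvt m hm).1 ⟨hm'.1, h'⟩
          · exact (hwt m hm).2 ⟨h', hm'.2⟩, fun hm' => by omega⟩
        rw [abs_of_neg (sub_neg.2 (hmono h))]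
        linarith
  refine ⟨c, ⟨?_, ?_, ?_⟩, hlow⟩
  · rintro j (rfl | hj)
    · simpa using hc0
    · simpa [update_of_ne (hne j hj)] using hφ.nonneg j hj
  · rintro i (rfl | hi) j (rfl | hj) hij hadj
    · exact absurd hij (lt_irrefl _)
    · rw [update_self, update_of_ne (hne j hj)]
      exact hright j hj (hadj.mono (Set.subset_insert _ _)).symm hij
    · rw [update_self, update_of_ne (hne i hi)]
      have := hlow i hi (hadj.mono (Set.subset_insert _ _))
      have := abs_nonneg (p j - p i)
      have := (hp i).1
      have := (hp j).1
      linarith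
    · rw [update_of_ne (hne i hi), update_of_ne (hne j hj)]
      exact hφ.left_le i hi j hj hij (hadj.mono (Set.subset_insert _ _))
  · rintro i (rfl | hi) j (rfl | hj) hij hadj
    · exact absurd hij (lt_irrefl _)
    · rw [update_self, update_of_ne (hne j hj)]
      have := hlow j hj (hadj.mono (Set.subset_insert _ _)).symm
      have := abs_nonneg (p i - p j)
      have := (hp i).2
      have := (hp j).2
      linarith
    · rw [update_self, update_of_ne (hne i hi)]
      exact hleft i hi (hadj.mono (Set.subset_insert _ _)) hij
    · rw [update_of_ne (hne i hi), update_of_ne (hne j hj)]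
      exact hφ.right_le i hi j hj hij (hadj.mono (Set.subset_insert _ _))

/-- A server that is highest after its insertion is a neighbour of the formerly highest one. -/
theorem IsHighest.isAdjacent_of_insert (hmono : StrictMono p) (hp : ∀ j, p j ∈ Set.Icc a b)
    (hw : IsHighest a b p S r w) (ht : IsHighest a b p (insert t S) r t) : IsAdjacent S w t := by
  refine fun m hm => ⟨fun ⟨h₁, h₂⟩ => ?_, fun ⟨h₁, h₂⟩ => ?_⟩
  -- A server `m` between `w` and `t` would give `B(m, t) < r ≤ B(w, m)`, against `B(w, m) < B(w, t)
  -- < B(m, t)`.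
  · have e₁ := (ht.2 m (Or.inr hm)).B_lt (hmono h₂)
    have e₂ := (hw.2 m hm).le_B (hmono h₁)
    have e₃ := B_lt_B_right (hp w).1 (hmono h₁) (hmono h₂) (hp t).2
    have e₄ := B_lt_B_left (hp w).1 (hmono h₁) (hmono h₂) (hp t).2
    linarith
  · have e₁ := (ht.2 m (Or.inr hm)).le_B (hmono h₁)
    have e₂ := (hw.2 m hm).B_lt (hmono h₂)
    have e₃ := B_lt_B_right (hp t).1 (hmono h₁) (hmono h₂) (hp w).2
    have e₄ := B_lt_B_left (hp t).1 (hmono h₁) (hmono h₂) (hp w).2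
    linarith

/-- The distance to the highest server plus its potential does not decrease when a server is
inserted. -/
theorem IsHighest.add_le_of_insert (hmono : StrictMono p) (hp : ∀ j, p j ∈ Set.Icc a b)
    {c : ℝ} (ht : t ∉ S) (hc : ∀ v ∈ S, IsAdjacent S v t → φ v + |p t - p v| ≤ c)
    (hw : IsHighest a b p S r w) (hw' : IsHighest a b p (insert t S) r w') :
    |r - p w| + φ w ≤ |r - p w'| + update φ t c w' := by
  by_cases h : w' = t
  · subst h
    have := hc w hw.1 (hw.isAdjacent_of_insert hmono hp hw')
    have := abs_sub_le r (p w') (p w)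
    rw [update_self]
    linarith
  · have hS : IsHighest a b p S r w' :=
      ⟨hw'.1.resolve_left h, fun j hj => hw'.2 j (Or.inr hj)⟩
    rw [update_of_ne h, hw.unique hmono.injective hS]

end Potential

/-! ### Comparing the potential with distances -/

section Lipschitz

variable {k : ℕ} {a b : ℝ} {p : Fin k → ℝ} {φ : Fin k → ℝ} {r : ℝ} {i j s w : Fin k}

theorem isAdjacent_univ_of_covBy (h : i ⋖ j) : IsAdjacent Set.univ i j :=
  fun _ _ => ⟨fun hm => h.2 hm.1 hm.2, fun hm => (hm.1.trans hm.2).not_gt h.1⟩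

theorem dMin_le_of_lt (hmono : StrictMono p) (h : i < j) : dMin p ≤ p j - p i := by
  have hk : (i : ℕ) < k - 1 := by omega
  have h₁ : dMin p ≤ p ⟨i + 1, by omega⟩ - p i :=
    ciInf_le (Set.finite_range fun i : Fin (k - 1) =>
      p ⟨i + 1, by omega⟩ - p ⟨i, by omega⟩).bddBelow ⟨i, hk⟩
  have h₂ : p ⟨i + 1, by omega⟩ ≤ p j := hmono.monotone (Fin.le_def.2 (by simp; omega))
  linarith

theorem dMin_pos (hmono : StrictMono p) (hk : 2 ≤ k) : 0 < dMin p := by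
  have : Nonempty (Fin (k - 1)) := ⟨⟨0, by omega⟩⟩
  obtain ⟨i, hi⟩ := exists_eq_ciInf_of_finite (f := fun i : Fin (k - 1) =>
    p ⟨i + 1, by omega⟩ - p ⟨i, by omega⟩)
  rw [dMin, ← hi, sub_pos]
  exact hmono (Fin.lt_def.2 (by simp))

/-- Two distinct servers force `2 ≤ k`, so `dMin p` is positive here and the convention for `k = 1`
plays no role. -/
theorem le_div_dMin_mul_of_lt (hmono : StrictMono p) (hp : ∀ j, p j ∈ Set.Icc a b) (h : i < j) :
    b - a ≤ (b - a) / dMin p * (p j - p i) := by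
  have hd := dMin_pos hmono (by omega)
  have hab : 0 ≤ b - a := by linarith [(hp i).1, (hp i).2]
  rw [div_mul_eq_mul_div, le_div_iff₀ hd]
  exact mul_le_mul_of_nonneg_left (dMin_le_of_lt hmono h) hab

/-- The bounds chain along consecutive servers: each jump is at most `2 * (b - a)`, and one gap
times `D` already covers `b - a`. -/
theorem IsPotential.le_add_of_le (hmono : StrictMono p) (hp : ∀ j, p j ∈ Set.Icc a b)
    (hφ : IsPotential a b p Set.univ φ) (h : i ≤ j) :
    φ j ≤ φ i + (2 * ((b - a) / dMin p) + 1) * (p j - p i) ∧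
      φ i ≤ φ j + (2 * ((b - a) / dMin p) + 1) * (p j - p i) := by
  set D := (b - a) / dMin p
  have h₁ : Monotone fun j => (2 * D + 1) * p j - φ j :=
    (monotone_iff_forall_covBy _).2 fun i j hij => by
      have := hφ.right_le i trivial j trivial hij.1 (isAdjacent_univ_of_covBy hij)
      have := le_div_dMin_mul_of_lt hmono hp hij.1
      have := (hp i).1
      have := hmono hij.1
      linarith
  have h₂ : Monotone fun j => (2 * D + 1) * p j + φ j :=
    (monotone_iff_forall_covBy _).2 fun i j hij => by
      have := hφ.left_le i trivial j trivial hij.1 (isAdjacent_univ_of_covBy hij)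
      have := le_div_dMin_mul_of_lt hmono hp hij.1
      have := (hp j).2
      have := hmono hij.1
      linarith
  have e₁ := h₁ h
  have e₂ := h₂ h
  dsimp only at e₁ e₂
  constructor <;> linarith

/-- This is where the ratio of `B` pays off: its denominator is `(b - a) + (p j - p i)`, which is at
most `(D + 1) * (p j - p i)`. -/
theorem two_mul_sub_le_mul_B_sub (hmono : StrictMono p) (hp : ∀ j, p j ∈ Set.Icc a b)
    (h : i < j) :
    2 * (b - p i) ≤ (2 * ((b - a) / dMin p) + 2) * (B a b (p i) (p j) - p i) ∧
      2 * (p j - a) ≤ (2 * ((b - a) / dMin p) + 2) * (p j - B a b (p i) (p j)) := by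
  have hij := hmono h
  have hD := le_div_dMin_mul_of_lt hmono hp h
  generalize (b - a) / dMin p = D at hD ⊢
  have hi := (hp i).1
  have hj := (hp j).2
  have hpos : 0 < (b - p i) + (p j - a) := by linarith
  rw [B_sub_left hpos.ne', right_sub_B hpos.ne', ← mul_div_assoc, ← mul_div_assoc,
    le_div_iff₀ hpos, le_div_iff₀ hpos]
  constructor
  · nlinarith [mul_le_mul_of_nonneg_left hD (show 0 ≤ b - p i by linarith)]
  · nlinarith [mul_le_mul_of_nonneg_left hD (show 0 ≤ p j - a by linarith)]

/-- The distance to the highest server plus its potential is controlled by every server. -/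
theorem IsPotential.add_le_of_isHighest (hmono : StrictMono p) (hp : ∀ j, p j ∈ Set.Icc a b)
    (hφ : IsPotential a b p Set.univ φ) (hw : IsHighest a b p Set.univ r w) (s : Fin k) :
    |r - p w| + φ w ≤ (2 * ((b - a) / dMin p) + 1) * |r - p s| + φ s := by
  rcases lt_trichotomy s w with h | rfl | h
  · obtain ⟨l, hsl, hlw⟩ := exists_le_covBy_of_lt h
    have hD := le_div_dMin_mul_of_lt hmono hp h
    have hB := (two_mul_sub_le_mul_B_sub hmono hp hlw.1).1
    have hLw := (hφ.le_add_of_le hmono hp h.le).1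
    have hLl := (hφ.le_add_of_le hmono hp hsl).1
    have hφw := hφ.right_le l trivial w trivial hlw.1 (isAdjacent_univ_of_covBy hlw)
    -- With `l` the server just left of `w`, the request lies beyond `B(l, w)`. If `r ≤ p w`, the
    -- charge at `w` is at most `φ l + 2 * (b - p l) - (r - p l)`, and `hB` bounds the middle term
    -- by `(2 * D + 2) * (r - p l)`.
    have hr := (hw.2 l trivial).B_lt (hmono hlw.1)
    have hlB := left_lt_B (hp l).1 (hmono hlw.1) (hp w).2
    have hD0 : 0 ≤ (b - a) / dMin p := div_nonneg (by linarith [(hp w).1, (hp w).2])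
      (dMin_pos hmono (by omega)).le
    set D := (b - a) / dMin p
    have hsl' := hmono.monotone hsl
    rw [abs_of_pos (show 0 < r - p s by linarith)]
    rcases le_total (p w) r with hrw | hrw
    · rw [abs_of_nonneg (by linarith)]
      linarith [mul_nonneg hD0 (show 0 ≤ r - p w by linarith)]
    · rw [abs_of_nonpos (by linarith)]
      linarith [mul_nonneg hD0 (show 0 ≤ r - B a b (p l) (p w) by linarith)]
  · have hD0 : 0 ≤ (b - a) / dMin p := by
      -- Only `0 ≤ dMin p` is available, since `k = 1` is possible here.
      refine div_nonneg (by linarith [(hp s).1, (hp s).2]) (Real.iInf_nonneg fun i => ?_)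
      exact sub_nonneg.2 (hmono.monotone (Fin.le_def.2 (by simp)))
    linarith [mul_nonneg hD0 (abs_nonneg (r - p s))]
  · obtain ⟨l, hwl, hls⟩ := exists_covBy_le_of_lt h
    have hD := le_div_dMin_mul_of_lt hmono hp h
    have hB := (two_mul_sub_le_mul_B_sub hmono hp hwl.1).2
    have hLw := (hφ.le_add_of_le hmono hp h.le).2
    have hLl := (hφ.le_add_of_le hmono hp hls).2
    have hφw := hφ.left_le w trivial l trivial hwl.1 (isAdjacent_univ_of_covBy hwl)
    have hr := (hw.2 l trivial).le_B (hmono hwl.1)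
    have hlB := B_lt_right (hp w).1 (hmono hwl.1) (hp l).2
    have hD0 : 0 ≤ (b - a) / dMin p := div_nonneg (by linarith [(hp w).1, (hp w).2])
      (dMin_pos hmono (by omega)).le
    set D := (b - a) / dMin p
    have hsl' := hmono.monotone hls
    rw [abs_of_neg (show r - p s < 0 by linarith)]
    rcases le_total (p w) r with hrw | hrw
    · rw [abs_of_nonneg (by linarith)]
      linarith [mul_nonneg hD0 (show 0 ≤ B a b (p w) (p l) - r by linarith)]
    · rw [abs_of_nonpos (by linarith)]
      linarith [mul_nonneg hD0 (show 0 ≤ p w - r by linarith)]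

end Lipschitz

/-! ### Loads and feasibility -/

section Load

variable {n k ℓ : ℕ}

theorem load_snoc (x : Fin n → Fin k) (c j : Fin k) :
    load (Fin.snoc (α := fun _ => Fin k) x c) j = load x j + if c = j then 1 else 0 := by
  simp only [load, Finset.card_filter, Fin.sum_univ_castSucc, Fin.snoc_castSucc, Fin.snoc_last]

theorem sum_load (x : Fin n → Fin k) : ∑ j, load x j = n := by
  simpa [load] using (Finset.card_eq_sum_card_fiberwise (f := x) (s := Finset.univ)
    (t := Finset.univ) (by simp)).symm

theorem exists_isFree (x : Fin n → Fin k) (hn : n < k * ℓ) : ∃ j, IsFree ℓ x j := by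
  by_contra! h
  have : ∑ _j : Fin k, ℓ ≤ ∑ j, load x j :=
    Finset.sum_le_sum fun j _ => not_lt.1 (h j)
  rw [sum_load] at this
  simp at this
  omega

theorem sum_comp_eq_sum_load_mul (x : Fin n → Fin k) (φ : Fin k → ℝ) :
    ∑ i, φ (x i) = ∑ j, load x j * φ j := by
  rw [← Finset.sum_fiberwise_of_maps_to (s := Finset.univ) (t := Finset.univ) (g := x) (by simp)]
  refine Finset.sum_congr rfl fun j _ => ?_
  rw [load, ← nsmul_eq_mul, ← Finset.sum_const]
  exact Finset.sum_congr rfl fun i hi => by rw [(Finset.mem_filter.1 hi).2]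

theorem OnlineAlgorithm.isFeasible_run (A : OnlineAlgorithm k ℓ) :
    ∀ {n : ℕ} (σ : Fin n → ℝ), n ≤ k * ℓ → IsFeasible ℓ (A.run σ)
  | 0, _, _ => fun j => by simp [load]
  | n + 1, σ, hn => fun j => by
    have hfree := A.choose_free (Fin.init σ) (A.run (Fin.init σ)) (σ (Fin.last n))
      (exists_isFree _ hn)
    rw [OnlineAlgorithm.run, load_snoc]
    split_ifs with h
    · rw [← h]
      exact hfree
    · exact A.isFeasible_run (Fin.init σ) (by omega) j

end Load

/-! ### Surrounding free servers -/

section Surrounding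

variable {n k ℓ : ℕ} {a b : ℝ} {p : Fin k → ℝ}

theorem exists_isLeftSurrounding (x : Fin n → Fin k) {r : ℝ} {j : Fin k} (hj : IsFree ℓ x j)
    (hjr : p j < r) : ∃ L, IsLeftSurrounding ℓ p x r L := by
  obtain ⟨L, hL, hmax⟩ := (Set.toFinite {j | IsFree ℓ x j ∧ p j < r}).exists_maximalFor p _
    ⟨j, hj, hjr⟩
  exact ⟨L, hL.1, hL.2, fun j hj hjr => (le_total (p j) (p L)).elim id (hmax ⟨hj, hjr⟩)⟩

theorem exists_isRightSurrounding (x : Fin n → Fin k) {r : ℝ} {j : Fin k} (hj : IsFree ℓ x j)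
    (hjr : r < p j) : ∃ R, IsRightSurrounding ℓ p x r R := by
  obtain ⟨R, hR, hmin⟩ := (Set.toFinite {j | IsFree ℓ x j ∧ r < p j}).exists_minimalFor p _
    ⟨j, hj, hjr⟩
  exact ⟨R, hR.1, hR.2, fun j hj hjr => (le_total (p R) (p j)).elim id (hmin ⟨hj, hjr⟩)⟩

theorem IsLeftSurrounding.prec (hp : ∀ j, p j ∈ Set.Icc a b) {x : Fin n → Fin k} {r : ℝ}
    {L j : Fin k} (hL : IsLeftSurrounding ℓ p x r L) (hj : IsFree ℓ x j) (hjr : p j < r) :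
    Prec a b r (p j) (p L) := by
  rcases (hL.2.2 j hj hjr).eq_or_lt with h | h
  · exact Or.inl h
  · exact Or.inr (Or.inl ⟨h, (B_lt_right (hp j).1 h (hp L).2).trans hL.2.1⟩)

theorem IsRightSurrounding.prec (hp : ∀ j, p j ∈ Set.Icc a b) {x : Fin n → Fin k} {r : ℝ}
    {R j : Fin k} (hR : IsRightSurrounding ℓ p x r R) (hj : IsFree ℓ x j) (hjr : r < p j) :
    Prec a b r (p j) (p R) := by
  rcases (hR.2.2 j hj hjr).eq_or_lt with h | h
  · exact Or.inl h.symm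
  · exact Or.inr (Or.inr ⟨h, (hR.2.1.trans (left_lt_B (hp R).1 h (hp j).2)).le⟩)

end Surrounding

/-! ### The three properties of IDAS -/

section Idas

variable {n k ℓ : ℕ} [NeZero k] {a b : ℝ} {p : Fin k → ℝ}

theorem idas_next_isHighestFree (hp : ∀ j, p j ∈ Set.Icc a b) (σ : Fin n → ℝ) (r : ℝ)
    (hn : n < k * ℓ) :
    IsHighestFree ℓ a b p ((idas ℓ a b p hp).run σ) r ((idas ℓ a b p hp).next σ r) :=
  Classical.epsilon_spec (exists_isHighestFree ℓ hp _ r (exists_isFree _ hn))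

theorem idas_next_eq (hinj : Function.Injective p) (hp : ∀ j, p j ∈ Set.Icc a b)
    (σ : Fin n → ℝ) (r : ℝ) (hn : n < k * ℓ) {j : Fin k}
    (hj : IsHighestFree ℓ a b p ((idas ℓ a b p hp).run σ) r j) :
    (idas ℓ a b p hp).next σ r = j :=
  IsHighest.unique (S := {j | IsFree ℓ ((idas ℓ a b p hp).run σ) j}) hinj
    (idas_next_isHighestFree hp σ r hn) hj

/-- The indices of an injective family of points of `[a, b]`, ordered by `⪯_r`. -/
@[reducible]
noncomputable def precOrder {ι : Type*} {p : ι → ℝ} (hinj : Function.Injective p)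
    (hp : ∀ j, p j ∈ Set.Icc a b) (r : ℝ) : LinearOrder ι where
  le i j := Prec a b r (p i) (p j)
  le_refl i := Prec.refl a b r (p i)
  le_trans i j l := Prec.trans (hp i) (hp j) (hp l)
  le_antisymm _ _ h h' := hinj (h.antisymm h')
  le_total i j := Prec.total a b r (p i) (p j)
  toDecidableLE := Classical.decRel _

theorem idas_isMPFS (hinj : Function.Injective p) (hp : ∀ j, p j ∈ Set.Icc a b) :
    (idas ℓ a b p hp).IsMPFS :=
  ⟨precOrder hinj hp, fun _ σ r hn => idas_next_isHighestFree hp σ r hn⟩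

theorem idas_followsInteriorDivision (hinj : Function.Injective p)
    (hp : ∀ j, p j ∈ Set.Icc a b) : (idas ℓ a b p hp).FollowsInteriorDivision a b p := by
  intro n σ r hn
  refine ⟨fun j hj hjr => idas_next_eq hinj hp σ r hn ⟨hj, fun j' _ => ?_⟩, fun hne =>
    ⟨fun L hL hR => idas_next_eq hinj hp σ r hn ⟨hL.1, fun j hj => ?_⟩,
      fun R hR hL => idas_next_eq hinj hp σ r hn ⟨hR.1, fun j hj => ?_⟩,
      fun L R hL hR => ⟨fun h => idas_next_eq hinj hp σ r hn ⟨hL.1, fun j hj => ?_⟩,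
        fun h => idas_next_eq hinj hp σ r hn ⟨hR.1, fun j hj => ?_⟩⟩⟩⟩
  · subst hjr
    rcases lt_trichotomy (p j') (p j) with h | h | h
    · exact Or.inr (Or.inl ⟨h, B_lt_right (hp j').1 h (hp j).2⟩)
    · exact Or.inl h
    · exact Or.inr (Or.inr ⟨h, (left_lt_B (hp j).1 h (hp j').2).le⟩)
  · rcases (hne j hj).lt_or_gt with h | h
    · exact hL.prec hp hj h
    · exact absurd (exists_isRightSurrounding _ hj h) hR
  · rcases (hne j hj).lt_or_gt with h | h
    · exact absurd (exists_isLeftSurrounding _ hj h) hL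
    · exact hR.prec hp hj h
  · rcases (hne j hj).lt_or_gt with h' | h'
    · exact hL.prec hp hj h'
    · exact (hR.prec hp hj h').trans (hp _) (hp _) (hp _)
        (Or.inr (Or.inr ⟨hL.2.1.trans hR.2.1, h⟩))
  · rcases (hne j hj).lt_or_gt with h' | h'
    · exact (hL.prec hp hj h').trans (hp _) (hp _) (hp _)
        (Or.inr (Or.inl ⟨hL.2.1.trans hR.2.1, h⟩))
    · exact hR.prec hp hj h'

/-- A potential on the servers that are free in the end extends to all servers so that it accounts
for the costs of all requests. -/
theorem exists_isPotential_of_run (hℓ : 1 ≤ ℓ) (hmono : StrictMono p)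
    (hp : ∀ j, p j ∈ Set.Icc a b) :
    ∀ {n : ℕ} (σ : Fin n → ℝ), n ≤ k * ℓ → ∀ φ : Fin k → ℝ,
      IsPotential a b p {j | IsFree ℓ ((idas ℓ a b p hp).run σ) j} φ →
      ∃ ψ, IsPotential a b p Set.univ ψ ∧
        (∀ j, IsFree ℓ ((idas ℓ a b p hp).run σ) j → ψ j = φ j) ∧
        (∀ r w w', IsHighestFree ℓ a b p ((idas ℓ a b p hp).run σ) r w →
          IsHighest a b p Set.univ r w' → |r - p w| + φ w ≤ |r - p w'| + ψ w') ∧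
        ∀ i w, IsHighest a b p Set.univ (σ i) w →
          |σ i - p ((idas ℓ a b p hp).run σ i)| + ψ ((idas ℓ a b p hp).run σ i) ≤
            |σ i - p w| + ψ w
  | 0, σ, _, φ, hφ => by
    have huniv : {j | IsFree ℓ ((idas ℓ a b p hp).run σ) j} = Set.univ :=
      Set.eq_univ_of_forall fun j => by simpa [IsFree, load] using Nat.lt_of_lt_of_le one_pos hℓ
    rw [huniv] at hφ
    refine ⟨φ, hφ, fun _ _ => rfl, fun r w w' hw hw' => ?_, fun i => i.elim0⟩
    change IsHighest a b p {j | IsFree ℓ ((idas ℓ a b p hp).run σ) j} r w at hw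
    rw [huniv] at hw
    rw [hw.unique hmono.injective hw']
  | n + 1, σ, hn, φ, hφ => by
    have ih := exists_isPotential_of_run hℓ hmono hp (Fin.init σ) (by omega)
    set A := idas ℓ a b p hp
    set x := A.run (Fin.init σ)
    set u := A.next (Fin.init σ) (σ (Fin.last n))
    have hrun : A.run σ = Fin.snoc (α := fun _ => Fin k) x u := rfl
    have hu : IsHighestFree ℓ a b p x (σ (Fin.last n)) u :=
      idas_next_isHighestFree hp _ _ hn
    have hfree : ∀ j, IsFree ℓ (A.run σ) j → IsFree ℓ x j := fun j hj => by
      unfold IsFree at hj ⊢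
      rw [hrun, load_snoc] at hj
      omega
    have hfree' : ∀ j, j ≠ u → IsFree ℓ x j → IsFree ℓ (A.run σ) j := fun j hju hj => by
      unfold IsFree at hj ⊢
      rwa [hrun, load_snoc, if_neg hju.symm]
    obtain ⟨χ, hχ, hχφ, hχmono⟩ : ∃ χ, IsPotential a b p {j | IsFree ℓ x j} χ ∧
        (∀ j, IsFree ℓ (A.run σ) j → χ j = φ j) ∧
        ∀ r w w', IsHighestFree ℓ a b p (A.run σ) r w → IsHighestFree ℓ a b p x r w' →
          |r - p w| + φ w ≤ |r - p w'| + χ w' := by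
      -- The set of free servers changes only if this request fills `u`; going back in time, `u` is
      -- then inserted.
      by_cases hu' : IsFree ℓ (A.run σ) u
      · have hS : {j | IsFree ℓ (A.run σ) j} = {j | IsFree ℓ x j} :=
          Set.ext fun j => ⟨hfree j, fun hj => (eq_or_ne j u).elim (fun h => h ▸ hu')
            fun h => hfree' j h hj⟩
        refine ⟨φ, hS ▸ hφ, fun _ _ => rfl, fun r w w' hw hw' => ?_⟩
        change IsHighest a b p {j | IsFree ℓ (A.run σ) j} r w at hw
        rw [hS] at hw
        rw [hw.unique hmono.injective hw']
      · have hS : insert u {j | IsFree ℓ (A.run σ) j} = {j | IsFree ℓ x j} := by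
          refine Set.ext fun j => ⟨?_, fun hj => (eq_or_ne j u).imp id fun h => hfree' j h hj⟩
          rintro (rfl | hj)
          · exact hu.1
          · exact hfree j hj
        obtain ⟨c, hc, hadj⟩ := hφ.exists_update hmono hp hu'
        refine ⟨Function.update φ u c, hS ▸ hc, fun j hj => Function.update_of_ne
          (by rintro rfl; exact hu' hj) _ _, fun r w w' hw hw' => ?_⟩
        change IsHighest a b p {j | IsFree ℓ x j} r w' at hw'
        rw [← hS] at hw'
        exact IsHighest.add_le_of_insert hmono hp hu' hadj hw hw'
    obtain ⟨ψ, hψ, hψχ, hψmono, hcost⟩ := ih χ hχ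
    refine ⟨ψ, hψ, fun j hj => (hψχ j (hfree j hj)).trans (hχφ j hj), fun r w w' hw hw' => ?_,
      fun i w hw => ?_⟩
    · obtain ⟨v, hv⟩ := exists_isHighestFree ℓ hp x r ⟨w, hfree w hw.1⟩
      exact (hχmono r w v hw hv).trans (hψmono r v w' hv hw')
    · rw [hrun]
      induction i using Fin.lastCases with
      | last =>
        rw [Fin.snoc_last, hψχ u hu.1]
        exact hψmono _ u w hu hw
      | cast i =>
        rw [Fin.snoc_castSucc]
        exact hcost i w hw

/-- The cost of IDAS against an arbitrary feasible assignment. -/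
theorem idas_cost_le (hℓ : 1 ≤ ℓ) (hmono : StrictMono p) (hp : ∀ j, p j ∈ Set.Icc a b)
    (σ : Fin n → ℝ) (hn : n ≤ k * ℓ) {y : Fin n → Fin k} (hy : IsFeasible ℓ y) :
    (idas ℓ a b p hp).cost p σ ≤ (2 * ((b - a) / dMin p) + 1) * matchingCost p σ y := by
  have h0 : IsPotential a b p {j | IsFree ℓ ((idas ℓ a b p hp).run σ) j} 0 :=
    ⟨fun _ _ => le_rfl,
      fun i _ j _ _ _ => by simp only [Pi.zero_apply]; linarith [(hp i).1, (hp j).1],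
      fun i _ j _ _ _ => by simp only [Pi.zero_apply]; linarith [(hp i).2, (hp j).2]⟩
  obtain ⟨ψ, hψ, hψ0, -, hcost⟩ := exists_isPotential_of_run hℓ hmono hp σ hn 0 h0
  unfold OnlineAlgorithm.cost
  set x := (idas ℓ a b p hp).run σ
  have hsum : ∑ i, (|σ i - p (x i)| + ψ (x i)) ≤
      ∑ i, ((2 * ((b - a) / dMin p) + 1) * |σ i - p (y i)| + ψ (y i)) := by
    refine Finset.sum_le_sum fun i _ => ?_
    -- Under the empty history every server is free, so this `w` is the highest of all servers.
    obtain ⟨w, -, hw⟩ := exists_isHighestFree (n := 0) ℓ hp Fin.elim0 (σ i)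
      ⟨0, by simpa [IsFree, load] using Nat.lt_of_lt_of_le one_pos hℓ⟩
    have hw' : IsHighest a b p Set.univ (σ i) w :=
      ⟨trivial, fun j _ => hw j (by simpa [IsFree, load] using Nat.lt_of_lt_of_le one_pos hℓ)⟩
    exact (hcost i w hw').trans (hψ.add_le_of_isHighest hmono hp hw' (y i))
  have hψsum : ∑ i, ψ (y i) ≤ ∑ i, ψ (x i) := by
    rw [sum_comp_eq_sum_load_mul, sum_comp_eq_sum_load_mul]
    refine Finset.sum_le_sum fun j _ => ?_
    -- A server left free has potential `0`; any other one has load at least `ℓ` under IDAS, hence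
    -- at least its load under `y`.
    by_cases hj : IsFree ℓ x j
    · simp [hψ0 j hj]
    · exact mul_le_mul_of_nonneg_right (by exact_mod_cast (hy j).trans (not_lt.1 hj))
        (hψ.nonneg j trivial)
  rw [Finset.sum_add_distrib, Finset.sum_add_distrib, ← Finset.mul_sum] at hsum
  unfold matchingCost
  linarith

theorem idas_competitiveRatio_le (hℓ : 1 ≤ ℓ) (hmono : StrictMono p)
    (hp : ∀ j, p j ∈ Set.Icc a b) :
    (idas ℓ a b p hp).competitiveRatio p ≤ ((2 * ((b - a) / dMin p) + 1 : ℝ) : EReal) := by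
  have hD0 : 0 ≤ (b - a) / dMin p := by
    refine div_nonneg (by linarith [(hp 0).1, (hp 0).2]) (Real.iInf_nonneg fun i => ?_)
    exact sub_nonneg.2 (hmono.monotone (Fin.le_def.2 (by simp)))
  refine iInf_le_of_le _ (iInf₂_le_of_le (by linarith) (fun n σ hn => ?_) le_rfl)
  have : Nonempty {x : Fin n → Fin k // IsFeasible ℓ x} :=
    ⟨⟨_, (idas ℓ a b p hp).isFeasible_run σ hn⟩⟩
  -- Dividing by the positive factor isolates the infimum `opt`, so that it suffices to bound each
  -- feasible assignment.
  rw [← div_le_iff₀' (by linarith)]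
  refine le_ciInf fun y => ?_
  rw [div_le_iff₀' (by linarith)]
  exact idas_cost_le hℓ hmono hp σ hn y.2

end Idas

end OFAL

theorem mainTheorem7 {k ℓ : ℕ} [NeZero k] (hℓ : 1 ≤ ℓ) {a b : ℝ} (hab : a < b)
    (p : Fin k → ℝ) (hmono : StrictMono p) (hp : ∀ j, p j ∈ Set.Icc a b) :
    (OFAL.idas ℓ a b p hp).IsMPFS ∧
    (OFAL.idas ℓ a b p hp).FollowsInteriorDivision a b p ∧
    (OFAL.idas ℓ a b p hp).competitiveRatio p ≤
      ((2 * ((b - a) / OFAL.dMin p) + 1 : ℝ) : EReal) :=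
  ⟨OFAL.idas_isMPFS hmono.injective hp, OFAL.idas_followsInteriorDivision hmono.injective hp,
    OFAL.idas_competitiveRatio_le hℓ hmono hp⟩
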